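/- A semiring here is commutative and unital. A preordered semiring $(S,\preccurlyeq)$ is a semiring with a reflexive and transitive relation such that $0\preccurlyeq 1$, and $a\preccurlyeq b$ implies $a+c\preccurlyeq b+c$ and $ac\preccurlyeq bc$ for all $c$. An element $u\in S$ is power universal if $1\preccurlyeq u$ and for every $x\in S\setminus\{0\}$ there is $k\in\mathbb{N}$ with $x\preccurlyeq u^k$ and $1\preccurlyeq u^kx$; $S$ is of polynomial growth if it has a power universal element. For a power universal $u$ the asymptotic preorder is defined by: $x\succsim y$ iff there is a sequence $(k_n)_{n\in\mathbb{N}}$ of natural numbers with $k_n/n\to 0$ and $u^{k_n}x^n\succcurlyeq y^n$ for all $n$ (this relation does not depend on the choice of $u$). The spectrum $\Delta(S,\preccurlyeq)$ is the set of semiring homomorphisms $f:S\to\mathbb{R}_{\ge 0}$ such that $a\preccurlyeq b$ implies $f(a)\le f(b)$; a subsemiring carries the restricted preorder. Let $(S,\preccurlyeq)$ be a preordered semiring of polynomial growth such that the canonical map $\mathbb{N}\to S$ is an order embedding. Let $M\subseteq S$, let $T\subseteq S\setminus\{0\}$ be a multiplicative set containing $1$, and let $S_0$ be the subsemiring generated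 by $M\cup T$. Suppose that (M1') for all $s\in S\setminus\{0\}$ there exist $m\in M$, $t_1,t_2\in T$ and $n\in\mathbb{N}$ such that $t_2\preccurlyeq n\,mt_1s$ and $mt_1s\preccurlyeq n\,t_2$; (M2') for all $m\in M$ and $t_1,t_2\in T$ such that $f\mapsto f(m)\frac{f(t_1)}{f(t_2)}$ is bounded on the set of $f\in\Delta(S_0,\preccurlyeq)$ with $f(t_2)\neq 0$, there is an $n\in\mathbb{N}$ such that $mt_1\preccurlyeq n\,t_2$. Then, for every power universal $u$ used to form $\succsim$ and for all $x,y\in S$, $$x\succsim y\iff\forall f\in\Delta(S,\preccurlyeq):\ f(x)\ge f(y).$$ -/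

import Mathlib

open Filter Topology
open scoped NNReal

/-- A preorder on a commutative semiring making it a preordered semiring:
`le a b` is read `a ≼ b`. -/
structure SemiringPreorder (S : Type*) [CommSemiring S] where
  le : S → S → Prop
  refl : ∀ a, le a a
  trans : ∀ a b c, le a b → le b c → le a c
  zero_le_one : le 0 1
  add_right : ∀ a b c, le a b → le (a + c) (b + c)
  mul_right : ∀ a b c, le a b → le (a * c) (b * c)

namespace SemiringPreorder

/-- The preorder induced on a subsemiring. -/
def restrict {S : Type*} [CommSemiring S] (P : SemiringPreorder S) (S₀ : Subsemiring S) :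
    SemiringPreorder S₀ where
  le a b := P.le (a : S) (b : S)
  refl a := P.refl a
  trans a b c := P.trans a b c
  zero_le_one := P.zero_le_one
  add_right a b c := P.add_right a b c
  mul_right a b c := P.mul_right a b c

/-- The canonical map `ℕ → S` is an order embedding. -/
def NatOrderEmbedding {S : Type*} [CommSemiring S] (P : SemiringPreorder S) : Prop :=
  ∀ m n : ℕ, P.le (m : S) (n : S) ↔ m ≤ n

/-- `u` is power universal. -/
def IsPowerUniversal {S : Type*} [CommSemiring S] (P : SemiringPreorder S) (u : S) : Prop :=
  P.le 1 u ∧ ∀ x : S, x ≠ 0 → ∃ k : ℕ, P.le x (u ^ k) ∧ P.le 1 (u ^ k * x)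

/-- `(S, ≼)` is of polynomial growth. -/
def PolynomialGrowth {S : Type*} [CommSemiring S] (P : SemiringPreorder S) : Prop :=
  ∃ u : S, P.IsPowerUniversal u

/-- The asymptotic preorder `x ≿ y` formed with the element `u`: there is a sublinear sequence
`k` of natural numbers with `u ^ k n * x ^ n ≽ y ^ n` for all `n`. -/
def AsympGE {S : Type*} [CommSemiring S] (P : SemiringPreorder S) (u x y : S) : Prop :=
  ∃ k : ℕ → ℕ, Tendsto (fun n : ℕ => (k n : ℝ) / (n : ℝ)) atTop (𝓝 0) ∧
    ∀ n : ℕ, P.le (y ^ n) (u ^ k n * x ^ n)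

/-- The spectrum `Δ(S, ≼)`: the set of monotone semiring homomorphisms `S → ℝ≥0`. -/
def spectrum {S : Type*} [CommSemiring S] (P : SemiringPreorder S) : Set (S →+* ℝ≥0) :=
  {f | ∀ a b : S, P.le a b → f a ≤ f b}

end SemiringPreorder

/-! Applying a monotone homomorphism to the asymptotic inequalities and letting the sublinear
exponent vanish gives the easy direction. The converse rests on an existence theorem: a consistent
preorder whose elements are all bounded by naturals has a monotone homomorphism to `ℝ≥0`, read off
from a total extension by rational cuts (`IsConsistent.exists_mem_spectrum`).

Elements of `S` need not be bounded by naturals, so this is used through a dichotomy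
(`exists_forall_pow_le_or_exists_mem_spectrum`). Given `t * (p * u) ≼ t * (n * q)`, impose `q ≼ p`
and cancel nonzero elements; this forces `u ≼ n`, so everything becomes bounded. If the result is
consistent, some `g` in the spectrum has `g q ≤ g p`. If not, the contradiction multiplied by
complete homogeneous polynomials gives `p ^ N ≼ w * q ^ N` up to a common natural factor, with `w`
independent of `N`.

For `p = y ^ j` and `q = x ^ j * u ^ 2` the first alternative fails because `g u > 1`; the second
costs `3` factors of `u` per `j` factors of `x`, and `j` is arbitrary. The a priori bound comes from
`exists_mul_le_of_forall_spectrum`: (M1') replaces a ratio of elements by some `m * t₁ / t₂`, and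
(M2') bounds that, once it is bounded on `Δ(S₀)`. Points of `Δ(S₀)` need not extend to `S`, so the
dichotomy is used again to transfer inequalities to them (`map_le_map_of_forall_spectrum`). -/

namespace SemiringPreorder

/-! ### Calculus of semiring preorders and total extensions -/

variable {S : Type*} [CommSemiring S] (P : SemiringPreorder S)

instance : Trans P.le P.le P.le := ⟨fun {a b c} => P.trans a b c⟩

theorem add_le_add {a b c d : S} (h : P.le a b) (h' : P.le c d) : P.le (a + c) (b + d) := by
  refine P.trans _ _ _ (P.add_right a b c h) ?_
  rw [add_comm b c, add_comm b d]
  exact P.add_right c d b h'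

theorem mul_le_mul {a b c d : S} (h : P.le a b) (h' : P.le c d) : P.le (a * c) (b * d) := by
  refine P.trans _ _ _ (P.mul_right a b c h) ?_
  rw [mul_comm b c, mul_comm b d]
  exact P.mul_right c d b h'

theorem pow_le_pow {a b : S} (h : P.le a b) (n : ℕ) : P.le (a ^ n) (b ^ n) := by
  induction n with
  | zero => simpa using P.refl 1
  | succ n ih => rw [pow_succ, pow_succ]; exact P.mul_le_mul ih h

theorem mul_left {a b : S} (c : S) (h : P.le a b) : P.le (c * a) (c * b) :=
  P.mul_le_mul (P.refl c) h

theorem le_of_eq {a b : S} (h : a = b) : P.le a b := h ▸ P.refl a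

theorem zero_le (a : S) : P.le 0 a := by
  simpa using P.mul_right 0 1 a P.zero_le_one

theorem le_add_right (a b : S) : P.le a (a + b) := by
  simpa using P.add_le_add (P.refl a) (P.zero_le b)

theorem le_add_left (a b : S) : P.le a (b + a) := by
  simpa using P.add_le_add (P.zero_le b) (P.refl a)

theorem natCast_le {m n : ℕ} (h : m ≤ n) : P.le (m : S) (n : S) := by
  obtain ⟨k, rfl⟩ := Nat.exists_eq_add_of_le h
  push_cast
  exact P.le_add_right _ _

theorem one_le_natCast {n : ℕ} (h : 1 ≤ n) : P.le 1 (n : S) := by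
  simpa using P.natCast_le (S := S) h

theorem le_mul_of_one_le {a : S} (b : S) (h : P.le 1 a) : P.le b (a * b) := by
  simpa using P.mul_right 1 a b h

theorem one_le_pow {a : S} (h : P.le 1 a) (n : ℕ) : P.le 1 (a ^ n) := by
  simpa using P.pow_le_pow h n

theorem pow_le_pow_right {a : S} (h : P.le 1 a) {m n : ℕ} (hmn : m ≤ n) :
    P.le (a ^ m) (a ^ n) := by
  obtain ⟨k, rfl⟩ := Nat.exists_eq_add_of_le hmn
  rw [add_comm, pow_add]
  exact P.le_mul_of_one_le _ (P.one_le_pow h k)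

/-- A relation holding up to a common summand may be repeated. -/
theorem natCast_mul_add_le {a b z : S} (h : P.le (a + z) (b + z)) (k : ℕ) :
    P.le (k * a + z) (k * b + z) := by
  induction k with
  | zero => simpa using P.refl z
  | succ k ih =>
    calc P.le (((k + 1 : ℕ) : S) * a + z) (k * a + (a + z)) := P.le_of_eq (by push_cast; ring)
      P.le _ (k * a + (b + z)) := P.add_le_add (P.refl _) h
      P.le _ (b + (k * a + z)) := P.le_of_eq (by ring)
      P.le _ (b + (k * b + z)) := P.add_le_add (P.refl _) ih
      P.le _ _ := P.le_of_eq (by push_cast; ring)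

/-- A relation holding up to a common factor holds, up to the same factor, for powers. -/
theorem mul_pow_le {t a b : S} (h : P.le (t * a) (t * b)) (n : ℕ) :
    P.le (t * a ^ n) (t * b ^ n) := by
  induction n with
  | zero => simpa using P.refl t
  | succ n ih =>
    calc P.le (t * a ^ (n + 1)) ((t * a) * a ^ n) := P.le_of_eq (by ring)
      P.le _ ((t * b) * a ^ n) := P.mul_right _ _ _ h
      P.le _ (b * (t * a ^ n)) := P.le_of_eq (by ring)
      P.le _ (b * (t * b ^ n)) := P.mul_left _ ih
      P.le _ _ := P.le_of_eq (by ring)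

/-- No natural number dominates its successor. -/
def IsConsistent : Prop := ∀ n : ℕ, ¬ P.le ((n : S) + 1) n

variable {P}

theorem IsConsistent.le_of_natCast_le (hP : P.IsConsistent) {m n : ℕ} (h : P.le (m : S) n) :
    m ≤ n := by
  by_contra! hlt
  refine hP n (P.trans _ _ _ ?_ h)
  simpa using P.natCast_le (S := S) (Nat.succ_le_of_lt hlt)

variable (P)

/-- The preorder obtained from `P` by imposing `a ≼ b` and cancelling the elements of `W`. -/
def adjoin (W : Submonoid S) (a b : S) : SemiringPreorder S where
  le x y := ∃ r ∈ W, ∃ s : S, P.le (r * x + s * b) (r * y + s * a)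
  refl x := ⟨1, W.one_mem, 0, by simpa using P.refl x⟩
  trans := by
    rintro x y z ⟨r, hr, s, h⟩ ⟨r', hr', s', h'⟩
    refine ⟨r * r', W.mul_mem hr hr', r' * s + r * s', ?_⟩
    calc P.le (r * r' * x + (r' * s + r * s') * b) (r' * (r * x + s * b) + r * s' * b) :=
          P.le_of_eq (by ring)
      P.le _ (r' * (r * y + s * a) + r * s' * b) := P.add_right _ _ _ (P.mul_left _ h)
      P.le _ (r * (r' * y + s' * b) + r' * s * a) := P.le_of_eq (by ring)
      P.le _ (r * (r' * z + s' * a) + r' * s * a) := P.add_right _ _ _ (P.mul_left _ h')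
      P.le _ _ := P.le_of_eq (by ring)
  zero_le_one := ⟨1, W.one_mem, 0, by simpa using P.zero_le_one⟩
  add_right := by
    rintro x y c ⟨r, hr, s, h⟩
    refine ⟨r, hr, s, ?_⟩
    convert P.add_right _ _ (r * c) h using 1 <;> ring
  mul_right := by
    rintro x y c ⟨r, hr, s, h⟩
    refine ⟨r, hr, s * c, ?_⟩
    convert P.mul_right _ _ c h using 1 <;> ring

theorem adjoin_le_of_le (W : Submonoid S) (a b : S) {x y : S} (h : P.le x y) :
    (P.adjoin W a b).le x y :=
  ⟨1, W.one_mem, 0, by simpa using h⟩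

theorem adjoin_le (W : Submonoid S) (a b : S) : (P.adjoin W a b).le a b :=
  ⟨1, W.one_mem, 1, by simpa [add_comm] using P.refl (a + b)⟩

theorem adjoin_le_of_mul_le (W : Submonoid S) (a b : S) {r x y : S} (hr : r ∈ W)
    (h : (P.adjoin W a b).le (r * x) (r * y)) : (P.adjoin W a b).le x y := by
  obtain ⟨r', hr', s, h⟩ := h
  exact ⟨r' * r, W.mul_mem hr' hr, s, by simpa [mul_assoc] using h⟩

variable {P}

/-- One of the two comparisons of `a` and `b` may be imposed consistently. -/
theorem IsConsistent.adjoin_or (hP : P.IsConsistent) (hb : ∀ x, ∃ n : ℕ, P.le x n) (a b : S) :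
    (P.adjoin ⊥ a b).IsConsistent ∨ (P.adjoin ⊥ b a).IsConsistent := by
  by_contra! hcon
  obtain ⟨h₁, h₂⟩ := hcon
  simp only [IsConsistent, not_forall, not_not] at h₁ h₂
  obtain ⟨n, r, hr, s, h⟩ := h₁
  obtain ⟨n', r', hr', s', h'⟩ := h₂
  rw [Submonoid.mem_bot] at hr hr'
  subst hr hr'
  -- Adding `s'` times the first contradiction to `s` times the second leaves `Z` on both sides and
  -- `s + s'` on the left only. Iterating makes `s` infinitesimal, so the term `s * a` in the first
  -- contradiction cannot compensate for the surplus `1`.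
  set Z : S := s * n' + s' * n + s * s' * (a + b) with hZ
  have hs : P.le (s + s' + Z) (0 + Z) := by
    calc P.le (s + s' + Z)
          (s' * (1 * (n + 1) + s * b) + s * (1 * (n' + 1) + s' * a)) := P.le_of_eq (by rw [hZ]; ring)
      P.le _ (s' * (1 * n + s * a) + s * (1 * n' + s' * b)) :=
          P.add_le_add (P.mul_left _ h) (P.mul_left _ h')
      P.le _ _ := P.le_of_eq (by rw [hZ]; ring)
  obtain ⟨K, hK⟩ := hb Z
  obtain ⟨c, hc⟩ := hb a
  have hsK (k : ℕ) : P.le (k * s) K := by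
    calc P.le (k * s) (k * s + (k * s' + Z)) := P.le_add_right _ _
      P.le _ (k * (s + s') + Z) := P.le_of_eq (by ring)
      P.le _ (k * 0 + Z) := P.natCast_mul_add_le hs k
      P.le _ K := by simpa using hK
  have h₃ : P.le ((1 + s * b) + n) (s * a + n) := by
    convert h using 1 <;> ring
  have hk (k : ℕ) : P.le (k : S) ((K * c + n : ℕ) : S) := by
    calc P.le (k : S) (k + (k * (s * b) + n)) := P.le_add_right _ _
      P.le _ (k * (1 + s * b) + n) := P.le_of_eq (by ring)
      P.le _ (k * (s * a) + n) := P.natCast_mul_add_le h₃ k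
      P.le _ ((k * s) * a + n) := P.le_of_eq (by ring)
      P.le _ (K * c + n) := P.add_right _ _ _ (P.mul_le_mul (hsK k) hc)
      P.le _ _ := P.le_of_eq (by push_cast; ring)
  have := hP.le_of_natCast_le (hk (K * c + n + 1))
  omega

/-- A bounded consistent preorder has a total consistent extension. -/
theorem IsConsistent.exists_total (hP : P.IsConsistent) (hb : ∀ x, ∃ n : ℕ, P.le x n) :
    ∃ Q : SemiringPreorder S, (∀ a b, P.le a b → Q.le a b) ∧ Q.IsConsistent ∧
      ∀ a b, Q.le a b ∨ Q.le b a := by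
  let F : Set (S → S → Prop) :=
    {R | ∃ Q : SemiringPreorder S, Q.le = R ∧ (∀ a b, P.le a b → Q.le a b) ∧ Q.IsConsistent}
  obtain ⟨R, -, hR⟩ := zorn_le_nonempty₀ F (by
    intro C hC hchain R₀ hR₀
    have hdir {R R' : S → S → Prop} (h : R ∈ C) (h' : R' ∈ C) : ∃ R'' ∈ C, R ≤ R'' ∧ R' ≤ R'' := by
      rcases hchain.total h h' with hle | hle
      · exact ⟨R', h', hle, le_rfl⟩
      · exact ⟨R, h, le_rfl, hle⟩
    have hsub {R : S → S → Prop} (h : R ∈ C) {a b : S} (hab : P.le a b) : R a b := by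
      obtain ⟨Q, rfl, hQ, -⟩ := hC h
      exact hQ a b hab
    refine ⟨fun a b => ∃ R ∈ C, R a b, ⟨⟨fun a b => ∃ R ∈ C, R a b, ?_, ?_, ?_, ?_, ?_⟩, rfl, ?_, ?_⟩, ?_⟩
    · exact fun a => ⟨R₀, hR₀, hsub hR₀ (P.refl a)⟩
    · rintro a b c ⟨R, hR, hab⟩ ⟨R', hR', hbc⟩
      obtain ⟨R'', hR'', h, h'⟩ := hdir hR hR'
      have hab' := h _ _ hab
      have hbc' := h' _ _ hbc
      refine ⟨R'', hR'', ?_⟩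
      obtain ⟨Q, rfl, -⟩ := hC hR''
      exact Q.trans a b c hab' hbc'
    · exact ⟨R₀, hR₀, hsub hR₀ P.zero_le_one⟩
    · rintro a b c ⟨R, hR, hab⟩
      refine ⟨R, hR, ?_⟩
      obtain ⟨Q, rfl, -⟩ := hC hR
      exact Q.add_right a b c hab
    · rintro a b c ⟨R, hR, hab⟩
      refine ⟨R, hR, ?_⟩
      obtain ⟨Q, rfl, -⟩ := hC hR
      exact Q.mul_right a b c hab
    · exact fun a b hab => ⟨R₀, hR₀, hsub hR₀ hab⟩
    · rintro n ⟨R, hR, h⟩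
      obtain ⟨Q, rfl, -, hQ⟩ := hC hR
      exact hQ n h
    · exact fun R hR a b hab => ⟨R, hR, hab⟩) P.le ⟨P, rfl, fun _ _ h => h, hP⟩
  obtain ⟨Q, rfl, hPQ, hQ⟩ := hR.prop
  -- By maximality, a relation that can be imposed consistently already holds.
  have key (a b : S) (h : (Q.adjoin ⊥ a b).IsConsistent) : Q.le a b :=
    hR.le_of_ge ⟨Q.adjoin ⊥ a b, rfl, fun x y hxy => Q.adjoin_le_of_le _ _ _ (hPQ x y hxy), h⟩
      (fun x y hxy => Q.adjoin_le_of_le _ _ _ hxy) _ _ (Q.adjoin_le ⊥ a b)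
  refine ⟨Q, hPQ, hQ, fun a b => ?_⟩
  exact (hQ.adjoin_or (fun x => (hb x).imp fun n => hPQ _ _) a b).imp (key a b) (key b a)

end SemiringPreorder

/-! ### The homomorphism defined by a total preorder -/

namespace SemiringPreorder

variable {S : Type*} [CommSemiring S] (P : SemiringPreorder S)

/-- The infimum of the fractions `p / q` with `q x ≼ p`. -/
noncomputable def upperValue (x : S) : ℝ :=
  sInf {r : ℝ | ∃ p q : ℕ, 1 ≤ q ∧ P.le (q * x) p ∧ r = p / q}

variable {P}

theorem mul_upperValue_le {x : S} {p q : ℕ} (h : P.le (q * x) p) :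
    q * P.upperValue x ≤ p := by
  rcases Nat.eq_zero_or_pos q with rfl | hq
  · simp
  have hle : P.upperValue x ≤ p / q := by
    refine csInf_le ⟨0, ?_⟩ ⟨p, q, hq, h, rfl⟩
    rintro r ⟨p, q, -, -, rfl⟩
    positivity
  have hq' : (0 : ℝ) < q := by exact_mod_cast hq
  rwa [le_div_iff₀ hq', mul_comm] at hle

theorem IsConsistent.le_mul_upperValue (hP : P.IsConsistent) (hb : ∀ x, ∃ n : ℕ, P.le x n)
    {x : S} {p q : ℕ} (hq : 1 ≤ q) (h : P.le p (q * x)) : p ≤ q * P.upperValue x := by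
  have hq' : (0 : ℝ) < q := by exact_mod_cast hq
  have hle : (p / q : ℝ) ≤ P.upperValue x := by
    obtain ⟨n, hn⟩ := hb x
    refine le_csInf ⟨n, n, 1, le_rfl, by simpa using hn, by simp⟩ ?_
    rintro r ⟨p', q', hq'', h', rfl⟩
    have h₃ : P.le ((q' * p : ℕ) : S) ((q * p' : ℕ) : S) := by
      push_cast
      calc P.le ((q' : S) * p) (q' * (q * x)) := P.mul_left _ h
        P.le _ (q * (q' * x)) := P.le_of_eq (by ring)
        P.le _ (q * p') := P.mul_left _ h'
    have h₄ : (q' * p : ℝ) ≤ q * p' := by exact_mod_cast hP.le_of_natCast_le h₃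
    rw [div_le_div_iff₀ hq' (by exact_mod_cast hq'')]
    linarith
  rwa [div_le_iff₀ hq', mul_comm] at hle

/-- In a total bounded consistent preorder, multiples of `x` lie between consecutive naturals. -/
theorem IsConsistent.exists_approx (hP : P.IsConsistent) (hb : ∀ x, ∃ n : ℕ, P.le x n)
    (ht : ∀ a b, P.le a b ∨ P.le b a) (x : S) {q : ℕ} (hq : 1 ≤ q) :
    ∃ p : ℕ, P.le p (q * x) ∧ P.le (q * x) (p + 1 : ℕ) ∧ (p : ℝ) ≤ q * P.upperValue x ∧
      q * P.upperValue x ≤ p + 1 := by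
  classical
  have hex : ∃ n : ℕ, P.le (q * x) (n + 1 : ℕ) := by
    obtain ⟨n, hn⟩ := hb (q * x)
    exact ⟨n, P.trans _ _ _ hn (P.natCast_le (by omega))⟩
  have hmin : P.le (Nat.find hex : S) (q * x) := by
    rcases Nat.eq_zero_or_pos (Nat.find hex) with h0 | hpos
    · rw [h0]
      simpa using P.zero_le _
    · have := Nat.find_min hex (Nat.sub_one_lt_of_lt hpos)
      rw [Nat.sub_add_cancel hpos] at this
      exact (ht _ _).resolve_right this
  refine ⟨Nat.find hex, hmin, Nat.find_spec hex, hP.le_mul_upperValue hb hq hmin, ?_⟩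
  exact_mod_cast mul_upperValue_le (Nat.find_spec hex)

theorem le_of_forall_natCast_mul_le {a b c : ℝ} (h : ∀ q : ℕ, 1 ≤ q → q * a ≤ q * b + c) :
    a ≤ b := by
  by_contra! hlt
  obtain ⟨q, hq⟩ := exists_nat_gt (c / (a - b))
  rw [div_lt_iff₀ (by linarith)] at hq
  have h1 := h (q + 1) (by omega)
  push_cast at h1
  nlinarith

/-- Totality places `q * x` between consecutive naturals, so `upperValue` is known up to `1 / q`.
Sums are compared at scale `q` with constant error, products at scale `q * q` with error linear in
`q`; the Archimedean property removes both. -/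
theorem IsConsistent.exists_mem_spectrum_of_total (hP : P.IsConsistent)
    (hb : ∀ x, ∃ n : ℕ, P.le x n) (ht : ∀ a b, P.le a b ∨ P.le b a) :
    ∃ f : S →+* ℝ≥0, f ∈ P.spectrum := by
  have hcast (n : ℕ) : P.upperValue (n : S) = n := by
    apply le_antisymm
    · simpa using mul_upperValue_le (P := P) (x := (n : S)) (p := n) (q := 1)
        (by simpa using P.refl _)
    · simpa using hP.le_mul_upperValue hb (x := (n : S)) (p := n) le_rfl (by simpa using P.refl _)
  have hnn (x : S) : 0 ≤ P.upperValue x := by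
    simpa using hP.le_mul_upperValue hb (x := x) (p := 0) le_rfl (by simpa using P.zero_le _)
  have h0 : P.upperValue (0 : S) = 0 := by exact_mod_cast hcast 0
  have hmono {x y : S} (h : P.le x y) : P.upperValue x ≤ P.upperValue y := by
    refine le_of_forall_natCast_mul_le (c := 1) fun q hq => ?_
    obtain ⟨p, -, h₂, h₃, -⟩ := hP.exists_approx hb ht y hq
    have := mul_upperValue_le (P.trans _ _ _ (P.mul_left _ h) h₂)
    push_cast at this
    linarith
  have hadd (x y : S) : P.upperValue (x + y) = P.upperValue x + P.upperValue y := by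
    apply le_antisymm
    · refine le_of_forall_natCast_mul_le (c := 2) fun q hq => ?_
      obtain ⟨p, -, h₂, h₃, -⟩ := hP.exists_approx hb ht x hq
      obtain ⟨p', -, h₂', h₃', -⟩ := hP.exists_approx hb ht y hq
      have := mul_upperValue_le (P := P) (x := x + y) (q := q) (p := (p + 1) + (p' + 1)) (by
        have h := P.add_le_add h₂ h₂'
        rw [← mul_add] at h
        exact_mod_cast h)
      push_cast at this
      linarith
    · refine le_of_forall_natCast_mul_le (c := 2) fun q hq => ?_
      obtain ⟨p, h₁, -, -, h₃⟩ := hP.exists_approx hb ht x hq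
      obtain ⟨p', h₁', -, -, h₃'⟩ := hP.exists_approx hb ht y hq
      have := hP.le_mul_upperValue hb (x := x + y) (q := q) (p := p + p') hq (by
        have h := P.add_le_add h₁ h₁'
        rw [← mul_add] at h
        exact_mod_cast h)
      push_cast at this
      linarith
  have hmul (x y : S) : P.upperValue (x * y) = P.upperValue x * P.upperValue y := by
    have hX := hnn x
    have hY := hnn y
    apply le_antisymm
    · refine le_of_forall_natCast_mul_le (c := P.upperValue x + P.upperValue y + 1) fun q hq => ?_
      obtain ⟨p, -, h₂, h₃, -⟩ := hP.exists_approx hb ht x hq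
      obtain ⟨p', -, h₂', h₃', -⟩ := hP.exists_approx hb ht y hq
      have := mul_upperValue_le (P := P) (x := x * y) (q := q * q) (p := (p + 1) * (p' + 1)) (by
        have h := P.mul_le_mul h₂ h₂'
        rw [mul_mul_mul_comm] at h
        exact_mod_cast h)
      push_cast at this
      have hq' : (1 : ℝ) ≤ q := by exact_mod_cast hq
      have h4 : ((p : ℝ) + 1) * (p' + 1) ≤ (q * P.upperValue x + 1) * (q * P.upperValue y + 1) := by
        gcongr
      refine le_of_mul_le_mul_left (a := (q : ℝ)) ?_ (by linarith)
      nlinarith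
    · refine le_of_forall_natCast_mul_le (c := P.upperValue x + P.upperValue y) fun q hq => ?_
      obtain ⟨p, h₁, -, h₂, h₃⟩ := hP.exists_approx hb ht x hq
      obtain ⟨p', h₁', -, h₂', h₃'⟩ := hP.exists_approx hb ht y hq
      have := hP.le_mul_upperValue hb (x := x * y) (q := q * q) (p := p * p')
        (Nat.mul_pos hq hq) (by
        have h := P.mul_le_mul h₁ h₁'
        rw [mul_mul_mul_comm] at h
        exact_mod_cast h)
      push_cast at this
      have hq' : (1 : ℝ) ≤ q := by exact_mod_cast hq
      have hX' : 0 ≤ q * P.upperValue x := by positivity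
      have hp' : (0 : ℝ) ≤ p' := by positivity
      refine le_of_mul_le_mul_left (a := (q : ℝ)) ?_ (by linarith)
      nlinarith [mul_nonneg hX' (sub_nonneg.2 h₃'), mul_nonneg hp' (sub_nonneg.2 h₃)]
  refine ⟨⟨⟨⟨fun x => ⟨P.upperValue x, hnn x⟩, ?_⟩, ?_⟩, ?_, ?_⟩, ?_⟩
  · exact NNReal.eq (by exact_mod_cast hcast 1)
  · exact fun x y => NNReal.eq (hmul x y)
  · exact NNReal.eq h0
  · exact fun x y => NNReal.eq (hadd x y)
  · exact fun a b h => hmono h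

/-- A bounded consistent preorder has nonempty spectrum. -/
theorem IsConsistent.exists_mem_spectrum (hP : P.IsConsistent) (hb : ∀ x, ∃ n : ℕ, P.le x n) :
    ∃ f : S →+* ℝ≥0, f ∈ P.spectrum := by
  obtain ⟨Q, hPQ, hQ, ht⟩ := hP.exists_total hb
  obtain ⟨f, hf⟩ := hQ.exists_mem_spectrum_of_total (fun x => (hb x).imp fun n => hPQ _ _) ht
  exact ⟨f, fun a b h => hf a b (hPQ a b h)⟩

end SemiringPreorder

/-! ### The dichotomy for powers -/

namespace SemiringPreorder

variable {S : Type*} [CommSemiring S] {P : SemiringPreorder S} {u : S}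

theorem ne_zero_of_one_le (h10 : ¬ P.le 1 0) {a : S} (h : P.le 1 a) : a ≠ 0 := by
  rintro rfl
  exact h10 h

theorem natCast_ne_zero (h10 : ¬ P.le 1 0) {n : ℕ} (h : 1 ≤ n) : (n : S) ≠ 0 :=
  ne_zero_of_one_le h10 (P.one_le_natCast h)

namespace IsPowerUniversal

theorem exists_le_pow (hu : P.IsPowerUniversal u) (x : S) : ∃ k : ℕ, P.le x (u ^ k) := by
  by_cases hx : x = 0
  · exact ⟨0, hx ▸ P.zero_le _⟩
  · exact (hu.2 x hx).imp fun k h => h.1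

theorem exists_one_le (hu : P.IsPowerUniversal u) {x : S} (hx : x ≠ 0) :
    ∃ k : ℕ, P.le 1 (u ^ k * x) :=
  (hu.2 x hx).imp fun _ h => h.2

theorem mul_ne_zero (hu : P.IsPowerUniversal u) (h10 : ¬ P.le 1 0) {a b : S} (ha : a ≠ 0)
    (hb : b ≠ 0) : a * b ≠ 0 := by
  obtain ⟨k, hk⟩ := hu.exists_one_le ha
  obtain ⟨l, hl⟩ := hu.exists_one_le hb
  intro hab
  have h := P.mul_le_mul hk hl
  rw [mul_mul_mul_comm, hab, mul_one, mul_zero] at h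
  exact h10 h

theorem pow_ne_zero (hu : P.IsPowerUniversal u) (h10 : ¬ P.le 1 0) {a : S} (ha : a ≠ 0) (n : ℕ) :
    a ^ n ≠ 0 := by
  induction n with
  | zero => rw [pow_zero]; exact ne_zero_of_one_le h10 (P.refl 1)
  | succ n ih => rw [pow_succ]; exact hu.mul_ne_zero h10 ih ha

/-- The multiplicative set of nonzero elements. -/
def nonzeroSubmonoid (hu : P.IsPowerUniversal u) (h10 : ¬ P.le 1 0) : Submonoid S where
  carrier := {a | a ≠ 0}
  mul_mem' := hu.mul_ne_zero h10
  one_mem' := ne_zero_of_one_le h10 (P.refl 1)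

theorem one_le_map (hu : P.IsPowerUniversal u) {f : S →+* ℝ≥0} (hf : f ∈ P.spectrum) :
    1 ≤ f u := by
  simpa using hf 1 u hu.1

theorem map_ne_zero (hu : P.IsPowerUniversal u) {f : S →+* ℝ≥0} (hf : f ∈ P.spectrum) {x : S}
    (hx : x ≠ 0) : f x ≠ 0 := by
  obtain ⟨k, hk⟩ := hu.exists_one_le hx
  intro h0
  simpa [h0] using hf _ _ hk

theorem one_lt_map (hu : P.IsPowerUniversal u) {f : S →+* ℝ≥0} (hf : f ∈ P.spectrum) :
    1 < f u := by
  refine lt_of_le_of_ne (hu.one_le_map hf) fun h => ?_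
  obtain ⟨k, hk⟩ := hu.exists_le_pow 2
  have := hf _ _ hk
  rw [map_pow, ← h, one_pow, map_ofNat] at this
  norm_num at this

end IsPowerUniversal

/-- The complete homogeneous polynomial of degree `N` in `p` and `q`. -/
def homogeneousSum (p q : S) : ℕ → S
  | 0 => 1
  | N + 1 => q * homogeneousSum p q N + p ^ (N + 1)

theorem pow_le_homogeneousSum (P : SemiringPreorder S) (p q : S) (N : ℕ) :
    P.le (p ^ N) (homogeneousSum p q N) := by
  cases N with
  | zero => rw [pow_zero]; exact P.refl 1
  | succ N => exact P.le_add_left _ _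

theorem mul_homogeneousSum_le {t p q : S} {n : ℕ} (h : P.le (t * p) (t * (n * q))) (N : ℕ) :
    ∃ c : ℕ, P.le (t * homogeneousSum p q N) (c * (t * q ^ N)) := by
  induction N with
  | zero => exact ⟨1, by simpa [homogeneousSum] using P.refl t⟩
  | succ N ih =>
    obtain ⟨c, hc⟩ := ih
    refine ⟨c + n ^ (N + 1), ?_⟩
    calc P.le (t * homogeneousSum p q (N + 1)) (q * (t * homogeneousSum p q N) + t * p ^ (N + 1)) :=
          P.le_of_eq (by rw [homogeneousSum]; ring)
      P.le _ (q * (c * (t * q ^ N)) + t * (n * q) ^ (N + 1)) :=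
          P.add_le_add (P.mul_left _ hc) (mul_pow_le _ h _)
      P.le _ _ := P.le_of_eq (by push_cast; ring)

/-- A subtraction-free telescoping: the hypothesis is weighted by `p ^ i * q ^ (N - i)` and summed,
and the mixed terms with coefficient `s` cancel through the induction. -/
theorem two_mul_homogeneousSum_le {r s p q : S} (h : P.le (2 * r + s * p) (r + s * q)) (N : ℕ) :
    P.le (2 * (r * homogeneousSum p q N) + s * p ^ (N + 1))
      (r * homogeneousSum p q N + s * q ^ (N + 1)) := by
  induction N with
  | zero => simpa [homogeneousSum] using h
  | succ N ih =>
    set Q := homogeneousSum p q N with hQ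
    have hQ' : homogeneousSum p q (N + 1) = q * Q + p ^ (N + 1) := rfl
    rw [hQ']
    calc P.le (2 * (r * (q * Q + p ^ (N + 1))) + s * p ^ (N + 1 + 1))
          (2 * (r * (q * Q)) + p ^ (N + 1) * (2 * r + s * p)) := P.le_of_eq (by ring)
      P.le _ (2 * (r * (q * Q)) + p ^ (N + 1) * (r + s * q)) :=
          P.add_le_add (P.refl _) (P.mul_left _ h)
      P.le _ (q * (2 * (r * Q) + s * p ^ (N + 1)) + r * p ^ (N + 1)) := P.le_of_eq (by ring)
      P.le _ (q * (r * Q + s * q ^ (N + 1)) + r * p ^ (N + 1)) := P.add_right _ _ _ (P.mul_left _ ih)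
      P.le _ _ := P.le_of_eq (by ring)

/-- The summand `r * Q` cannot be cancelled, but iterating `c` times makes it negligible: one
leftover copy is absorbed by `t * Q ≼ c * (t * q ^ N)`. The constant `c` depends on `N` but appears
on both sides, so `w` does not. -/
theorem exists_forall_pow_le {r s t p q : S} {n : ℕ} (hu : P.IsPowerUniversal u)
    (h10 : ¬ P.le 1 0) (hr : r ≠ 0) (ht : t ≠ 0) (hpq : P.le (t * p) (t * (n * q)))
    (h : P.le (2 * r + s * p) (r + s * q)) :
    ∃ w : S, ∀ N : ℕ, ∃ c : ℕ, 1 ≤ c ∧ P.le (c * p ^ N) (c * (w * q ^ N)) := by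
  obtain ⟨l, hl⟩ := hu.exists_one_le (hu.mul_ne_zero h10 ht hr)
  refine ⟨u ^ l * t * (s * q + r), fun N => ?_⟩
  obtain ⟨c, hc⟩ := mul_homogeneousSum_le hpq N
  refine ⟨c + 1, by omega, ?_⟩
  set Q := homogeneousSum p q N with hQ
  have h₁ : P.le (r * Q + r * Q) (s * q ^ (N + 1) + r * Q) := by
    calc P.le (r * Q + r * Q) (2 * (r * Q) + s * p ^ (N + 1)) := by
          rw [← two_mul]; exact P.le_add_right _ _
      P.le _ (r * Q + s * q ^ (N + 1)) := two_mul_homogeneousSum_le h N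
      P.le _ _ := P.le_of_eq (by ring)
  have h₂ : P.le (t * (((c + 1 : ℕ) : S) * (r * Q))) (c * (t * (s * q + r) * q ^ N)) := by
    calc P.le (t * (((c + 1 : ℕ) : S) * (r * Q))) (t * (c * (r * Q) + r * Q)) :=
          P.le_of_eq (by push_cast; ring)
      P.le _ (t * (c * (s * q ^ (N + 1)) + r * Q)) := P.mul_left _ (P.natCast_mul_add_le h₁ c)
      P.le _ (c * t * (s * q ^ (N + 1)) + r * (t * Q)) := P.le_of_eq (by ring)
      P.le _ (c * t * (s * q ^ (N + 1)) + r * (c * (t * q ^ N))) :=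
          P.add_le_add (P.refl _) (P.mul_left _ hc)
      P.le _ _ := P.le_of_eq (by ring)
  calc P.le (((c + 1 : ℕ) : S) * p ^ N) (((c + 1 : ℕ) : S) * Q) :=
        P.mul_left _ (pow_le_homogeneousSum P p q N)
    P.le _ (u ^ l * (t * r) * (((c + 1 : ℕ) : S) * Q)) := P.le_mul_of_one_le _ hl
    P.le _ (u ^ l * (t * (((c + 1 : ℕ) : S) * (r * Q)))) := P.le_of_eq (by ring)
    P.le _ (u ^ l * (c * (t * (s * q + r) * q ^ N))) := P.mul_left _ h₂
    P.le _ (c * (u ^ l * t * (s * q + r) * q ^ N)) := P.le_of_eq (by ring)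
    P.le _ _ := P.mul_right _ _ _ (P.natCast_le (Nat.le_succ c))

/-- If `p / q` is at most a multiple of `1 / u`, then either its powers are bounded or some
monotone homomorphism takes a value at least `1` on it. -/
theorem exists_forall_pow_le_or_exists_mem_spectrum {t p q : S} {n : ℕ}
    (hu : P.IsPowerUniversal u) (h10 : ¬ P.le 1 0) (ht : t ≠ 0) (hp : p ≠ 0)
    (h : P.le (t * (p * u)) (t * (n * q))) :
    (∃ w : S, ∀ N : ℕ, ∃ c : ℕ, 1 ≤ c ∧ P.le (c * p ^ N) (c * (w * q ^ N))) ∨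
      ∃ g ∈ P.spectrum, g q ≤ g p := by
  set W := hu.nonzeroSubmonoid h10
  have hpq : P.le (t * p) (t * (n * q)) := by
    refine P.trans _ _ _ ?_ h
    simpa [mul_assoc, mul_comm, mul_left_comm] using P.mul_left (t * p) hu.1
  by_cases hcon : (P.adjoin W q p).IsConsistent
  · right
    set P' := P.adjoin W q p
    have hPP' {x y : S} : P.le x y → P'.le x y := P.adjoin_le_of_le W q p
    have hun : P'.le u n := by
      refine P.adjoin_le_of_mul_le W q p (r := t * p) (hu.mul_ne_zero h10 ht hp) ?_
      calc P'.le (t * p * u) (t * (p * u)) := P'.le_of_eq (by ring)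
        P'.le _ (t * (n * q)) := hPP' h
        P'.le _ (t * (n * p)) := P'.mul_left _ (P'.mul_left _ (P.adjoin_le W q p))
        P'.le _ _ := P'.le_of_eq (by ring)
    obtain ⟨g, hg⟩ := hcon.exists_mem_spectrum fun x => by
      obtain ⟨k, hk⟩ := hu.exists_le_pow x
      refine ⟨n ^ k, ?_⟩
      push_cast
      exact P'.trans _ _ _ (hPP' hk) (P'.pow_le_pow hun k)
    exact ⟨g, fun a b hab => hg a b (hPP' hab), hg q p (P.adjoin_le W q p)⟩
  · left
    simp only [IsConsistent, not_forall, not_not] at hcon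
    obtain ⟨m, r, hr, s, h'⟩ := hcon
    have h₁ : P.le ((r + s * p) + r * m) (s * q + r * m) := by
      convert h' using 1 <;> ring
    -- The gain `2 * (m + 1) * r` is twice `(m + 1) * r`, which dominates the leftover `r * m`.
    have h₂ := P.natCast_mul_add_le h₁ (2 * (m + 1))
    have hr' : ((m + 1 : ℕ) : S) * r ≠ 0 :=
      hu.mul_ne_zero h10 (natCast_ne_zero h10 (by omega)) hr
    refine exists_forall_pow_le hu h10 hr' ht hpq (s := ((2 * (m + 1) : ℕ) : S) * s) ?_
    calc P.le (2 * (((m + 1 : ℕ) : S) * r) + ((2 * (m + 1) : ℕ) : S) * s * p)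
          (2 * (((m + 1 : ℕ) : S) * r) + ((2 * (m + 1) : ℕ) : S) * s * p + r * m) :=
          P.le_add_right _ _
      P.le _ (((2 * (m + 1) : ℕ) : S) * (r + s * p) + r * m) := P.le_of_eq (by push_cast; ring)
      P.le _ (((2 * (m + 1) : ℕ) : S) * (s * q) + r * m) := h₂
      P.le _ (((2 * (m + 1) : ℕ) : S) * (s * q) + r * (m + 1 : ℕ)) :=
          P.add_le_add (P.refl _) (P.mul_left _ (P.natCast_le (Nat.le_succ m)))
      P.le _ _ := P.le_of_eq (by push_cast; ring)

end SemiringPreorder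

/-! ### Comparison of exponential growth rates -/

namespace NNReal

theorem exists_mul_pow_lt_mul_pow {a b : ℝ≥0} (h : b < a) {c : ℝ≥0} (hc : 0 < c) (d : ℝ≥0) :
    ∃ N : ℕ, d * b ^ N < c * a ^ N := by
  have ha : 0 < a := pos_of_gt h
  obtain ⟨N, hN⟩ := exists_pow_lt_of_lt_one (div_pos hc (show 0 < d + 1 by positivity))
    ((div_lt_one ha).2 h)
  refine ⟨N, ?_⟩
  rw [div_pow, div_lt_div_iff₀ (by positivity) (by positivity)] at hN
  refine lt_of_le_of_lt ?_ hN
  rw [mul_comm d]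
  exact mul_le_mul_right (le_self_add : d ≤ d + 1) _

theorem le_of_forall_mul_pow_le {a b c d : ℝ≥0} (hc : 0 < c)
    (h : ∀ N : ℕ, c * a ^ N ≤ d * b ^ N) : a ≤ b := by
  by_contra! hlt
  obtain ⟨N, hN⟩ := exists_mul_pow_lt_mul_pow hlt hc d
  exact absurd (h N) (not_le.2 hN)

end NNReal

/-! ### Comparability and transfer to the spectrum of the subsemiring -/

namespace SemiringPreorder

variable {S : Type*} [CommSemiring S] {P : SemiringPreorder S} {u : S}

variable (P) in
/-- Each of the two elements is at most a natural multiple of the other. -/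
def Comparable (a b : S) : Prop := ∃ n : ℕ, P.le a (n * b) ∧ P.le b (n * a)

namespace Comparable

theorem refl (a : S) : P.Comparable a a := ⟨1, by simpa using P.refl a, by simpa using P.refl a⟩

theorem symm {a b : S} (h : P.Comparable a b) : P.Comparable b a :=
  h.imp fun _ h => h.symm

theorem mul {a b c d : S} (h : P.Comparable a b) (h' : P.Comparable c d) :
    P.Comparable (a * c) (b * d) := by
  obtain ⟨n, h₁, h₂⟩ := h
  obtain ⟨m, h₁', h₂'⟩ := h'
  refine ⟨n * m, ?_, ?_⟩
  · convert P.mul_le_mul h₁ h₁' using 1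
    push_cast; ring
  · convert P.mul_le_mul h₂ h₂' using 1
    push_cast; ring

theorem trans {a b c : S} (h : P.Comparable a b) (h' : P.Comparable b c) : P.Comparable a c := by
  obtain ⟨n, h₁, h₂⟩ := h
  obtain ⟨m, h₁', h₂'⟩ := h'
  refine ⟨n * m, P.trans _ _ _ h₁ ?_, P.trans _ _ _ h₂' ?_⟩
  · convert P.mul_left n h₁' using 1
    push_cast; ring
  · convert P.mul_left m h₂ using 1
    push_cast; ring

end Comparable

theorem exists_comparable_mul {M : Set S} {T : Submonoid S} (hT : (0 : S) ∉ T)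
    (hu : P.IsPowerUniversal u) (h10 : ¬ P.le 1 0)
    (hM1 : ∀ s : S, s ≠ 0 → ∃ m ∈ M, ∃ t₁ ∈ T, ∃ t₂ ∈ T, P.Comparable (m * t₁ * s) t₂)
    {s : S} (hs : s ≠ 0) : ∃ m ∈ M, m ≠ 0 ∧ ∃ t₁ ∈ T, ∃ t₂ ∈ T, P.Comparable (m * t₁ * s) t₂ := by
  obtain ⟨m, hm, t₁, ht₁, t₂, ht₂, h⟩ := hM1 s hs
  refine ⟨m, hm, ?_, t₁, ht₁, t₂, ht₂, h⟩
  rintro rfl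
  obtain ⟨n, -, h⟩ := h
  obtain ⟨k, hk⟩ := hu.exists_one_le (fun h0 => hT (h0 ▸ ht₂))
  refine h10 (P.trans _ _ _ hk ?_)
  simpa using P.mul_left (u ^ k) h

/-- The hypothesis inverts `s`, up to constants, by a fraction `m * t₁ / t₂`. Inverting `m` in turn
expresses `s` itself as such a fraction. -/
theorem exists_mul_comparable {M : Set S} {T : Submonoid S} (hT : (0 : S) ∉ T)
    (hu : P.IsPowerUniversal u) (h10 : ¬ P.le 1 0)
    (hM1 : ∀ s : S, s ≠ 0 → ∃ m ∈ M, ∃ t₁ ∈ T, ∃ t₂ ∈ T, P.Comparable (m * t₁ * s) t₂)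
    {s : S} (hs : s ≠ 0) : ∃ m ∈ M, ∃ t₁ ∈ T, ∃ t₂ ∈ T, P.Comparable (s * t₂) (m * t₁) := by
  obtain ⟨m, hm, hm0, t₁, ht₁, t₂, ht₂, h⟩ := exists_comparable_mul hT hu h10 hM1 hs
  obtain ⟨m', hm', -, t₁', ht₁', t₂', ht₂', h'⟩ := exists_comparable_mul hT hu h10 hM1 hm0
  refine ⟨m', hm', t₂ * t₁', T.mul_mem ht₂ ht₁', t₁ * t₂', T.mul_mem ht₁ ht₂', ?_⟩
  have e₁ := (Comparable.refl (P := P) (s * t₁)).mul h'.symm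
  have e₂ := h.mul (Comparable.refl (P := P) (m' * t₁'))
  rw [show m * t₁ * s * (m' * t₁') = s * t₁ * (m' * t₁' * m) by ring] at e₂
  convert e₁.trans e₂ using 1 <;> ring

theorem exists_mul_comparable_mul {M : Set S} {T : Submonoid S} (hT : (0 : S) ∉ T)
    (hu : P.IsPowerUniversal u) (h10 : ¬ P.le 1 0)
    (hM1 : ∀ s : S, s ≠ 0 → ∃ m ∈ M, ∃ t₁ ∈ T, ∃ t₂ ∈ T, P.Comparable (m * t₁ * s) t₂)
    {a b : S} (ha : a ≠ 0) (hb : b ≠ 0) :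
    ∃ m ∈ M, ∃ t₁ ∈ T, ∃ t₂ ∈ T, P.Comparable (a * t₂) (b * (m * t₁)) := by
  obtain ⟨m, hm, hm0, t₁, ht₁, t₂, ht₂, h⟩ := exists_comparable_mul hT hu h10 hM1 hb
  obtain ⟨m', hm', t₁', ht₁', t₂', ht₂', h'⟩ :=
    exists_mul_comparable hT hu h10 hM1 (hu.mul_ne_zero h10 hm0 ha)
  refine ⟨m', hm', t₁ * t₁', T.mul_mem ht₁ ht₁', t₂ * t₂', T.mul_mem ht₂ ht₂', ?_⟩
  have e₁ := (Comparable.refl (P := P) (a * t₂')).mul h.symm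
  have e₂ := (Comparable.refl (P := P) (b * t₁)).mul h'
  rw [show a * t₂' * (m * t₁ * b) = b * t₁ * (m * a * t₂') by ring] at e₁
  convert e₁.trans e₂ using 1 <;> ring

section Restrict

variable {S₀ : Subsemiring S} {f : S₀ →+* ℝ≥0} {σ τ : S₀} {n : ℕ}

/-- The factor `w` may lie outside `S₀`. It is dominated by `u ^ K`, and multiplication by `τ ^ K`
turns this into `(n * σ) ^ K`, to which `f` applies; a factor independent of `N` is lost in the
limit. -/
theorem map_le_map_of_restrict (hu : P.IsPowerUniversal u) (hf : f ∈ (P.restrict S₀).spectrum)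
    (hτ : f τ ≠ 0) (hτσ : P.le (u * τ) (n * σ)) {x y : S₀} {w : S}
    (h : ∀ N : ℕ, ∃ c : ℕ, 1 ≤ c ∧ P.le (c * (x : S) ^ N) (c * (w * (y : S) ^ N))) :
    f x ≤ f y := by
  obtain ⟨K, hK⟩ := hu.exists_le_pow w
  refine NNReal.le_of_forall_mul_pow_le (c := f τ ^ K) (d := (n * f σ) ^ K)
    (pow_pos (pos_iff_ne_zero.2 hτ) K) fun N => ?_
  obtain ⟨c, hc, hN⟩ := h N
  have h' : P.le ((τ ^ K * (c * x ^ N) : S₀) : S) ((((n : S₀) * σ) ^ K * (c * y ^ N) : S₀) : S) := by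
    push_cast
    calc P.le ((τ : S) ^ K * (c * x ^ N)) (τ ^ K * (c * (w * y ^ N))) := P.mul_left _ hN
      P.le _ (w * (τ ^ K * (c * y ^ N))) := P.le_of_eq (by ring)
      P.le _ (u ^ K * (τ ^ K * (c * y ^ N))) := P.mul_right _ _ _ hK
      P.le _ ((u * τ) ^ K * (c * y ^ N)) := P.le_of_eq (by ring)
      P.le _ _ := P.mul_right _ _ _ (P.pow_le_pow hτσ K)
  have h'' := hf _ _ h'
  simp only [map_mul, map_pow, map_natCast] at h''
  have hc' : (0 : ℝ≥0) < c := by exact_mod_cast hc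
  refine le_of_mul_le_mul_left (a := (c : ℝ≥0)) ?_ hc'
  calc (c : ℝ≥0) * (f τ ^ K * f x ^ N) = f τ ^ K * (c * f x ^ N) := by ring
    _ ≤ _ := h''
    _ = _ := by ring

/-- An inequality that holds on the spectrum of `S` holds at those points of the spectrum of the
subsemiring at which `u`, up to a constant, takes a finite value. -/
theorem map_le_map_of_forall_spectrum (hu : P.IsPowerUniversal u) (h10 : ¬ P.le 1 0)
    (hf : f ∈ (P.restrict S₀).spectrum) (hτ : f τ ≠ 0) (hτσ : P.le (u * τ) (n * σ))
    (hσ0 : (σ : S) ≠ 0) {a b : S₀}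
    (ha : (a : S) ≠ 0) (hb : (b : S) ≠ 0) (h : ∀ g ∈ P.spectrum, g (a : S) ≤ g (b : S)) :
    f a ≤ f b := by
  by_contra! hlt
  have hτ0 : (τ : S) ≠ 0 := by
    intro h0
    exact hτ (by rw [show τ = 0 from Subtype.ext h0, map_zero])
  obtain ⟨p, hp⟩ := NNReal.exists_mul_pow_lt_mul_pow hlt one_pos 2
  rw [one_mul] at hp
  obtain ⟨k, hk⟩ := hu.exists_le_pow (a : S)
  obtain ⟨l, hl⟩ := hu.exists_one_le hb
  obtain ⟨ρ, hρ⟩ := exists_nat_ge (f σ / f τ)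
  rw [div_le_iff₀ (pos_iff_ne_zero.2 hτ)] at hρ
  -- The choice of `ρ'` makes `f σ ≤ f τ * ρ'`, so adding `σ ^ q` in `y` at most doubles its value
  -- under `f`, which the factor `2` in `hp` outweighs. The summand `σ ^ q` provides `x * u ≼ const
  -- * y` and makes `g x < g y` strict on the spectrum of `S`.
  set ρ' := ρ + 1 with hρ'
  have hρσ : f σ ≤ f τ * ρ' := by
    refine hρ.trans ?_
    rw [mul_comm, hρ']
    gcongr
    exact le_self_add
  have hρ0 : (ρ' : ℝ≥0) ≠ 0 := by rw [hρ']; positivity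
  -- `a ^ p` costs `u ^ ((l + k) * p)` over `b ^ p`; the extra `1` pays for the factor `u` required
  -- by the dichotomy.
  set q := (l + k) * p + 1 with hq
  set x : S₀ := a ^ p * (τ * ρ') ^ q with hx
  set y : S₀ := b ^ p * ((τ * ρ') ^ q + σ ^ q) with hy
  have hab : P.le (a : S) (u ^ (l + k) * b) := by
    calc P.le (a : S) (u ^ l * b * a) := P.le_mul_of_one_le _ hl
      P.le _ (u ^ l * b * u ^ k) := P.mul_left _ hk
      P.le _ _ := P.le_of_eq (by ring)
  have hxy : P.le (1 * ((x : S) * u)) (1 * ((((n * ρ') ^ q : ℕ) : S) * y)) := by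
    rw [one_mul, one_mul, hx, hy]
    push_cast
    calc P.le ((a : S) ^ p * (τ * ρ') ^ q * u) ((u ^ (l + k) * b) ^ p * (τ * ρ') ^ q * u) :=
          P.mul_right _ _ _ (P.mul_right _ _ _ (P.pow_le_pow hab p))
      P.le _ ((u * τ) ^ q * (b ^ p * ρ' ^ q)) := P.le_of_eq (by rw [hq]; ring)
      P.le _ ((n * σ) ^ q * (b ^ p * ρ' ^ q)) := P.mul_right _ _ _ (P.pow_le_pow hτσ q)
      P.le _ (((n : S) * ρ') ^ q * (b ^ p * σ ^ q)) := P.le_of_eq (by ring)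
      P.le _ _ := P.mul_left _ (P.mul_left _ (P.le_add_left _ _))
  have hρS : (ρ' : S) ≠ 0 := natCast_ne_zero h10 (by omega)
  have hx0 : (x : S) ≠ 0 := by
    rw [hx]
    push_cast
    exact hu.mul_ne_zero h10 (hu.pow_ne_zero h10 ha p)
      (hu.pow_ne_zero h10 (hu.mul_ne_zero h10 hτ0 hρS) q)
  rcases exists_forall_pow_le_or_exists_mem_spectrum hu h10 (ne_zero_of_one_le h10 (P.refl 1)) hx0
    hxy with ⟨w, hw⟩ | ⟨g, hg, hle⟩
  · have hle := map_le_map_of_restrict hu hf hτ hτσ hw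
    refine absurd hle (not_le.2 ?_)
    simp only [hx, hy, map_mul, map_pow, map_add, map_natCast]
    calc f b ^ p * ((f τ * ρ') ^ q + f σ ^ q) ≤ f b ^ p * ((f τ * ρ') ^ q + (f τ * ρ') ^ q) := by
          gcongr
      _ = 2 * f b ^ p * (f τ * ρ') ^ q := by ring
      _ < _ := by
          gcongr
  · rw [hx, hy] at hle
    push_cast at hle
    simp only [map_mul, map_pow, map_add] at hle
    have hgab := h g hg
    refine absurd hle (not_le.2 ?_)
    calc g (a : S) ^ p * (g (τ : S) * g (ρ' : S₀)) ^ q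
        ≤ g (b : S) ^ p * (g (τ : S) * g (ρ' : S₀)) ^ q := by gcongr
      _ < _ := by
        have h1 := pos_iff_ne_zero.2 (hu.map_ne_zero hg hb)
        have h3 : 0 < g (ρ' : S₀) := by
          exact pos_iff_ne_zero.2 (hu.map_ne_zero hg hρS)
        have h2 := pos_iff_ne_zero.2 (hu.map_ne_zero hg hσ0)
        gcongr
        exact lt_add_of_pos_right _ (by positivity)

end Restrict

end SemiringPreorder

/-! ### A priori bounds, nonempty spectrum and the asymptotic preorder -/

namespace SemiringPreorder

variable {S : Type*} [CommSemiring S] {P : SemiringPreorder S} {u : S}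

theorem IsPowerUniversal.ne_zero_of_le (hu : P.IsPowerUniversal u) (h10 : ¬ P.le 1 0) {a b : S}
    (ha : a ≠ 0) (h : P.le a b) : b ≠ 0 := by
  rintro rfl
  obtain ⟨k, hk⟩ := hu.exists_one_le ha
  refine h10 (P.trans _ _ _ hk ?_)
  simpa using P.mul_left (u ^ k) h

/-- An inequality on the spectrum gives a comparison up to a natural multiple and a factor in `T`. -/
theorem exists_mul_le_of_forall_spectrum {M : Set S} {T : Submonoid S} (hT : (0 : S) ∉ T)
    {S₀ : Subsemiring S} (hMS : M ⊆ S₀) (hTS : (T : Set S) ⊆ S₀)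
    (hu : P.IsPowerUniversal u) (h10 : ¬ P.le 1 0)
    (hM1 : ∀ s : S, s ≠ 0 → ∃ m ∈ M, ∃ t₁ ∈ T, ∃ t₂ ∈ T, P.Comparable (m * t₁ * s) t₂)
    (hM2 : ∀ m t₁ t₂ : S₀, (m : S) ∈ M → (t₁ : S) ∈ T → (t₂ : S) ∈ T →
      BddAbove ((fun f : S₀ →+* ℝ≥0 => f m * (f t₁ / f t₂)) ''
        {f | f ∈ (P.restrict S₀).spectrum ∧ f t₂ ≠ 0}) →
      ∃ n : ℕ, P.le ((m : S) * (t₁ : S)) ((n : S) * (t₂ : S)))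
    {a b : S} (ha : a ≠ 0) (hb : b ≠ 0) (h : ∀ g ∈ P.spectrum, g a ≤ g b) :
    ∃ t ∈ T, ∃ n : ℕ, P.le (t * a) (n * (t * b)) := by
  have hT0 {t : S} (ht : t ∈ T) : t ≠ 0 := fun h0 => hT (h0 ▸ ht)
  have hu0 : u ≠ 0 := ne_zero_of_one_le h10 hu.1
  obtain ⟨m₀, hm₀, s₁, hs₁, τ, hτ, n₀, hτσ, -⟩ := exists_mul_comparable hT hu h10 hM1 hu0
  have hσ0 : m₀ * s₁ ≠ 0 := by
    have := hu.ne_zero_of_le h10 (hu.mul_ne_zero h10 hu0 (hT0 hτ)) hτσ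
    exact fun h0 => this (by rw [h0, mul_zero])
  obtain ⟨m, hm, t₁, ht₁, t₂, ht₂, N, h₁, h₂⟩ := exists_mul_comparable_mul hT hu h10 hM1 ha hb
  have hmt0 : m * t₁ ≠ 0 := by
    have := hu.ne_zero_of_le h10 (hu.mul_ne_zero h10 ha (hT0 ht₂)) h₁
    exact fun h0 => this (by rw [h0, mul_zero, mul_zero])
  have hNt0 : (N : S) * t₂ ≠ 0 := by
    have := hu.ne_zero_of_le h10 (hu.mul_ne_zero h10 hb hmt0) h₂
    exact fun h0 => this (by rw [mul_left_comm, h0, mul_zero])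
  -- The common factor `τ` leaves the quotient unchanged but restricts the boundedness condition to
  -- those `f` with `f τ ≠ 0`, where the transfer applies.
  obtain ⟨n, hn⟩ := hM2 ⟨m, hMS hm⟩ (⟨t₁, hTS ht₁⟩ * ⟨τ, hTS hτ⟩) (⟨t₂, hTS ht₂⟩ * ⟨τ, hTS hτ⟩) hm
    (T.mul_mem ht₁ hτ) (T.mul_mem ht₂ hτ) (by
      refine ⟨N, ?_⟩
      rintro _ ⟨f, ⟨hf, hf0⟩, rfl⟩
      rw [map_mul] at hf0
      have hτ0 := right_ne_zero_of_mul hf0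
      have ht0 := left_ne_zero_of_mul hf0
      have key := map_le_map_of_forall_spectrum (σ := ⟨m₀, hMS hm₀⟩ * ⟨s₁, hTS hs₁⟩)
        (a := ⟨m, hMS hm⟩ * ⟨t₁, hTS ht₁⟩) (b := N * ⟨t₂, hTS ht₂⟩)
        hu h10 hf hτ0 hτσ hσ0 hmt0 hNt0 (fun g hg => by
          have hg₂ := hg _ _ h₂
          have hgb := pos_iff_ne_zero.2 (hu.map_ne_zero hg hb)
          change g (m * t₁) ≤ g (N * t₂)
          simp only [map_mul, map_natCast] at hg₂ ⊢
          refine le_of_mul_le_mul_left (hg₂.trans ?_) hgb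
          calc (N : ℝ≥0) * (g a * g t₂) ≤ N * (g b * g t₂) := by
                have := h g hg
                gcongr
            _ = _ := by ring)
      simp only [map_mul, map_natCast] at key ⊢
      rw [mul_div_mul_right _ _ hτ0, ← mul_div_assoc, div_le_iff₀ (pos_iff_ne_zero.2 ht0)]
      exact key)
  refine ⟨t₂ * τ, T.mul_mem ht₂ hτ, N * n, ?_⟩
  change P.le (m * (t₁ * τ)) (n * (t₂ * τ)) at hn
  calc P.le (t₂ * τ * a) (τ * (a * t₂)) := P.le_of_eq (by ring)
    P.le _ (τ * (N * (b * (m * t₁)))) := P.mul_left _ h₁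
    P.le _ (N * b * (m * (t₁ * τ))) := P.le_of_eq (by ring)
    P.le _ (N * b * (n * (t₂ * τ))) := P.mul_left _ hn
    P.le _ _ := P.le_of_eq (by push_cast; ring)

/-- On an empty spectrum every inequality holds vacuously. Transferring `2 ≤ 1` empties `Δ(S₀)` too,
so (M2') applies unconditionally and bounds `u` by a natural number. The preorder is then bounded
and consistent, so its spectrum is nonempty after all. -/
theorem spectrum_nonempty {M : Set S} {T : Submonoid S} (hT : (0 : S) ∉ T)
    {S₀ : Subsemiring S} (hMS : M ⊆ S₀) (hTS : (T : Set S) ⊆ S₀)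
    (hu : P.IsPowerUniversal u) (hnat : P.NatOrderEmbedding)
    (hM1 : ∀ s : S, s ≠ 0 → ∃ m ∈ M, ∃ t₁ ∈ T, ∃ t₂ ∈ T, P.Comparable (m * t₁ * s) t₂)
    (hM2 : ∀ m t₁ t₂ : S₀, (m : S) ∈ M → (t₁ : S) ∈ T → (t₂ : S) ∈ T →
      BddAbove ((fun f : S₀ →+* ℝ≥0 => f m * (f t₁ / f t₂)) ''
        {f | f ∈ (P.restrict S₀).spectrum ∧ f t₂ ≠ 0}) →
      ∃ n : ℕ, P.le ((m : S) * (t₁ : S)) ((n : S) * (t₂ : S))) :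
    P.spectrum.Nonempty := by
  have h10 : ¬ P.le 1 0 := by simpa using hnat 1 0
  by_contra hempty
  have hempty' (g : S →+* ℝ≥0) (hg : g ∈ P.spectrum) : False := hempty ⟨g, hg⟩
  have h1 : (1 : S) ≠ 0 := ne_zero_of_one_le h10 (P.refl 1)
  have hT0 {t : S} (ht : t ∈ T) : t ≠ 0 := fun h0 => hT (h0 ▸ ht)
  obtain ⟨τ, hτ, n, hn⟩ := exists_mul_le_of_forall_spectrum hT hMS hTS hu h10 hM1 hM2
    (ne_zero_of_one_le h10 hu.1) h1 (fun g hg => (hempty' g hg).elim)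
  obtain ⟨k, hk⟩ := hu.exists_one_le (hT0 hτ)
  have hpow (i : ℕ) : P.le (τ * u ^ i) (τ * (n : S) ^ i) :=
    P.mul_pow_le (by simpa [mul_comm] using hn) i
  have hτ1 : P.le 1 ((n ^ k : ℕ) * τ) := by
    refine P.trans _ _ _ hk ?_
    simpa [mul_comm] using hpow k
  have hrestrict (f : S₀ →+* ℝ≥0) (hf : f ∈ (P.restrict S₀).spectrum) : False := by
    have hfτ : f ⟨τ, hTS hτ⟩ ≠ 0 := by
      have h := hf 1 (((n ^ k : ℕ) : S₀) * (⟨τ, hTS hτ⟩ : S₀)) hτ1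
      intro h0
      simp [h0] at h
    have h2 : ((2 : ℕ) : S) ≠ 0 := natCast_ne_zero h10 (by omega)
    have h := map_le_map_of_forall_spectrum (a := ((2 : ℕ) : S₀)) (b := 1) (σ := ⟨τ, hTS hτ⟩)
      (n := n) hu h10 hf hfτ
      (by simpa [mul_comm] using hn) (hT0 hτ) h2 h1 (fun g hg => (hempty' g hg).elim)
    rw [map_natCast, map_one] at h
    norm_num at h
  have hM2' {m t₁ t₂ : S} (hm : m ∈ M) (ht₁ : t₁ ∈ T) (ht₂ : t₂ ∈ T) :
      ∃ n : ℕ, P.le (m * t₁) (n * t₂) := by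
    refine hM2 ⟨m, hMS hm⟩ ⟨t₁, hTS ht₁⟩ ⟨t₂, hTS ht₂⟩ hm ht₁ ht₂ ⟨0, ?_⟩
    rintro _ ⟨f, ⟨hf, -⟩, -⟩
    exact (hrestrict f hf).elim
  obtain ⟨m, hm, t₁, ht₁, t₂, ht₂, c, -, hc⟩ := hM1 1 h1
  obtain ⟨l, hl⟩ := hu.exists_one_le (hT0 ht₂)
  -- The power `τ ^ (l + 1)` matches the bound below: one `τ` from `u` itself and `l` from `u ^ l`.
  obtain ⟨d, hd⟩ := hM2' hm (T.mul_mem ht₁ (T.pow_mem hτ (l + 1))) T.one_mem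
  have huτ : P.le u ((n ^ k * n : ℕ) * τ) := by
    calc P.le u (u * ((n ^ k : ℕ) * τ)) := by simpa using P.mul_left u hτ1
      P.le _ ((n ^ k : ℕ) * (τ * u)) := P.le_of_eq (by ring)
      P.le _ ((n ^ k : ℕ) * (n * (τ * 1))) := P.mul_left _ hn
      P.le _ _ := P.le_of_eq (by push_cast; ring)
  have hub : ∃ B : ℕ, P.le u B := by
    refine ⟨(n ^ k * n) * ((n ^ k * n) ^ l * (c * d)), ?_⟩
    calc P.le u (((n ^ k * n : ℕ) : S) * τ) := huτ
      P.le _ (((n ^ k * n : ℕ) : S) * (τ * (u ^ l * t₂))) := by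
          simpa [mul_assoc] using P.mul_left (((n ^ k * n : ℕ) : S) * τ) hl
      P.le _ (((n ^ k * n : ℕ) : S) * (τ * ((((n ^ k * n : ℕ) : S) * τ) ^ l * (c * (m * t₁ * 1))))) :=
          P.mul_left _ (P.mul_left _ (P.mul_le_mul (P.pow_le_pow huτ l) hc))
      P.le _ (((n ^ k * n : ℕ) : S) * (((n ^ k * n : ℕ) : S) ^ l * c) * (m * (t₁ * τ ^ (l + 1)))) :=
          P.le_of_eq (by ring)
      P.le _ (((n ^ k * n : ℕ) : S) * (((n ^ k * n : ℕ) : S) ^ l * c) * (d * 1)) := P.mul_left _ hd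
      P.le _ _ := P.le_of_eq (by push_cast; ring)
  obtain ⟨B, hB⟩ := hub
  have hcon : P.IsConsistent := by
    intro i hi
    have := (hnat (i + 1) i).1 (by exact_mod_cast hi)
    omega
  obtain ⟨f, hf⟩ := hcon.exists_mem_spectrum fun x => by
    obtain ⟨i, hi⟩ := hu.exists_le_pow x
    refine ⟨B ^ i, P.trans _ _ _ hi ?_⟩
    push_cast
    exact P.pow_le_pow hB i
  exact hempty' f hf

theorem AsympGE.map_le_map (hu : P.IsPowerUniversal u) {x y : S} (h : P.AsympGE u x y)
    {f : S →+* ℝ≥0} (hf : f ∈ P.spectrum) : f y ≤ f x := by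
  obtain ⟨k, hk, hle⟩ := h
  by_contra! hlt
  -- A gap of a whole factor `f u` per `j` powers beats `u ^ k n` as soon as `k n * j ≤ n`.
  obtain ⟨j, hj⟩ := NNReal.exists_mul_pow_lt_mul_pow hlt one_pos (f u)
  rw [one_mul] at hj
  have hev : ∀ᶠ n : ℕ in atTop, (k n : ℝ) / n < 1 / (j + 1) :=
    hk.eventually_lt_const (by positivity)
  obtain ⟨n, hn, hn1⟩ := (hev.and (eventually_ge_atTop 1)).exists
  have hn1' : (0 : ℝ) < n := by exact_mod_cast hn1
  rw [div_lt_div_iff₀ hn1' (by positivity)] at hn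
  have hkn : k n * j ≤ n := by
    have : (k n : ℝ) * j ≤ n := by nlinarith [(Nat.cast_nonneg (k n) : (0 : ℝ) ≤ k n)]
    exact_mod_cast this
  have h₁ := hf _ _ (hle n)
  simp only [map_mul, map_pow] at h₁
  refine absurd (pow_lt_pow_left₀ hj (by positivity) (by omega : n ≠ 0)) (not_lt.2 ?_)
  calc (f y ^ j) ^ n = (f y ^ n) ^ j := pow_right_comm _ _ _
    _ ≤ (f u ^ k n * f x ^ n) ^ j := by gcongr
    _ = f u ^ (k n * j) * (f x ^ j) ^ n := by rw [mul_pow, ← pow_mul, pow_right_comm]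
    _ ≤ f u ^ n * (f x ^ j) ^ n := by
        have := hu.one_le_map hf
        gcongr
    _ = (f u * f x ^ j) ^ n := (mul_pow _ _ _).symm

/-- It suffices to bound `y ^ n` by `u ^ k n * x ^ n` along multiples of a fixed exponent. -/
theorem asympGE_of_forall_exists (hu : P.IsPowerUniversal u) (h10 : ¬ P.le 1 0) {x y : S}
    (hx : x ≠ 0)
    (h : ∀ j : ℕ, 1 ≤ j → ∃ N : ℕ, 1 ≤ N ∧ ∃ l : ℕ, ∀ k : ℕ,
      P.le ((y ^ j) ^ (N * k)) (u ^ (l + 3 * (N * k)) * (x ^ j) ^ (N * k))) :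
    P.AsympGE u x y := by
  classical
  have hex (n : ℕ) : ∃ k : ℕ, P.le (y ^ n) (u ^ k * x ^ n) := by
    obtain ⟨k, hk⟩ := hu.exists_le_pow (y ^ n)
    obtain ⟨l, hl⟩ := hu.exists_one_le (hu.pow_ne_zero h10 hx n)
    refine ⟨k + l, ?_⟩
    calc P.le (y ^ n) (u ^ l * x ^ n * y ^ n) := P.le_mul_of_one_le _ hl
      P.le _ (u ^ l * x ^ n * u ^ k) := P.mul_left _ hk
      P.le _ _ := P.le_of_eq (by ring)
  refine ⟨fun n => Nat.find (hex n), ?_, fun n => Nat.find_spec (hex n)⟩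
  rw [Metric.tendsto_atTop]
  intro ε hε
  -- The term `3 * (N * i)` is at most `3 * n / j`, hence at most `ε * n / 2`; the constants `l` and
  -- `E`, the latter covering remainders modulo `j * N`, use the other half for large `n`.
  obtain ⟨j, hj⟩ := exists_nat_gt (6 / ε)
  have hj0 : (0 : ℝ) < j := lt_trans (by positivity) hj
  obtain ⟨N, hN, l, hl⟩ := h j (by exact_mod_cast hj0)
  set E := ∑ r ∈ Finset.range (j * N), Nat.find (hex r) with hE
  have hbound (n : ℕ) : Nat.find (hex n) ≤ l + 3 * (N * (n / (j * N))) + E := by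
    refine Nat.find_min' _ ?_
    have hr : n % (j * N) < j * N := Nat.mod_lt _ (Nat.mul_pos (by exact_mod_cast hj0) hN)
    have hn : j * (N * (n / (j * N))) + n % (j * N) = n := by
      rw [← mul_assoc]
      exact Nat.div_add_mod n (j * N)
    have hle : Nat.find (hex (n % (j * N))) ≤ E :=
      Finset.single_le_sum (f := fun r => Nat.find (hex r)) (fun _ _ => Nat.zero_le _)
        (Finset.mem_range.2 hr)
    set i := n / (j * N)
    set r := n % (j * N)
    calc P.le (y ^ n) ((y ^ j) ^ (N * i) * y ^ r) :=
          P.le_of_eq (by rw [← pow_mul, ← pow_add, hn])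
      P.le _ ((u ^ (l + 3 * (N * i)) * (x ^ j) ^ (N * i)) * (u ^ Nat.find (hex r) * x ^ r)) :=
          P.mul_le_mul (hl i) (Nat.find_spec (hex r))
      P.le _ ((u ^ (l + 3 * (N * i)) * (x ^ j) ^ (N * i)) * (u ^ E * x ^ r)) :=
          P.mul_left _ (P.mul_right _ _ _ (P.pow_le_pow_right hu.1 hle))
      P.le _ (u ^ (l + 3 * (N * i) + E) * x ^ (j * (N * i) + r)) := P.le_of_eq (by ring)
      P.le _ _ := P.le_of_eq (by rw [hn])
  obtain ⟨n₀, hn₀⟩ := exists_nat_gt (2 * (l + E) / ε)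
  refine ⟨n₀ + 1, fun n hn => ?_⟩
  have hn0 : (0 : ℝ) < n := by exact_mod_cast (by omega : 0 < n)
  have hnn₀ : (n₀ : ℝ) ≤ n := by exact_mod_cast (by omega : n₀ ≤ n)
  rw [Real.dist_eq, sub_zero, abs_of_nonneg (by positivity), div_lt_iff₀ hn0]
  have h₁ : (Nat.find (hex n) : ℝ) ≤ l + 3 * (N * (n / (j * N) : ℕ)) + E := by
    exact_mod_cast hbound n
  have h₂ : (j : ℝ) * (N * (n / (j * N) : ℕ)) ≤ n := by
    rw [← mul_assoc]
    exact_mod_cast Nat.mul_div_le n (j * N)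
  rw [div_lt_iff₀ hε] at hj hn₀
  have h₃ : ε * j * (N * (n / (j * N) : ℕ)) ≤ ε * n := by
    rw [mul_assoc]
    gcongr
  have h₄ : 6 * ((N : ℝ) * (n / (j * N) : ℕ)) ≤ ε * n := by
    refine le_trans ?_ h₃
    gcongr
    linarith
  have h₅ : (n₀ : ℝ) * ε ≤ n * ε := by gcongr
  linarith

end SemiringPreorder

theorem corollary3 {S : Type*} [CommSemiring S] (P : SemiringPreorder S)
    (hgrowth : P.PolynomialGrowth) (hnat : P.NatOrderEmbedding)
    (M : Set S) (T : Submonoid S) (hT : (0 : S) ∉ T)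
    (S₀ : Subsemiring S) (hS₀ : S₀ = Subsemiring.closure (M ∪ (T : Set S)))
    (hM1 : ∀ s : S, s ≠ 0 → ∃ m ∈ M, ∃ t₁ ∈ T, ∃ t₂ ∈ T, ∃ n : ℕ,
      P.le t₂ ((n : S) * (m * t₁ * s)) ∧ P.le (m * t₁ * s) ((n : S) * t₂))
    (hM2 : ∀ m t₁ t₂ : S₀, (m : S) ∈ M → (t₁ : S) ∈ T → (t₂ : S) ∈ T →
      BddAbove ((fun f : S₀ →+* ℝ≥0 => f m * (f t₁ / f t₂)) ''
        {f | f ∈ (P.restrict S₀).spectrum ∧ f t₂ ≠ 0}) →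
      ∃ n : ℕ, P.le ((m : S) * (t₁ : S)) ((n : S) * (t₂ : S))) :
    ∀ u : S, P.IsPowerUniversal u →
      ∀ x y : S, P.AsympGE u x y ↔ ∀ f ∈ P.spectrum, f y ≤ f x := by
  intro u hu x y
  refine ⟨fun h f hf => h.map_le_map hu hf, fun h => ?_⟩
  have h10 : ¬ P.le 1 0 := by simpa using hnat 1 0
  have hMT : M ∪ (T : Set S) ⊆ S₀ := hS₀ ▸ Subsemiring.subset_closure
  have hMS := Set.subset_union_left.trans hMT
  have hTS := Set.subset_union_right.trans hMT
  have hM1' (s : S) (hs : s ≠ 0) :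
      ∃ m ∈ M, ∃ t₁ ∈ T, ∃ t₂ ∈ T, P.Comparable (m * t₁ * s) t₂ := by
    obtain ⟨m, hm, t₁, ht₁, t₂, ht₂, n, h₁, h₂⟩ := hM1 s hs
    exact ⟨m, hm, t₁, ht₁, t₂, ht₂, n, h₂, h₁⟩
  by_cases hy : y = 0
  · subst hy
    refine ⟨fun _ => 0, by simp, fun n => ?_⟩
    rcases Nat.eq_zero_or_pos n with rfl | hn
    · simpa using P.refl 1
    · rw [zero_pow hn.ne']
      exact P.zero_le _
  by_cases hx : x = 0
  · subst hx
    -- Here the hypothesis reads `f y ≤ 0`, which is contradictory only if the spectrum has a point.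
    obtain ⟨f, hf⟩ := SemiringPreorder.spectrum_nonempty hT hMS hTS hu hnat hM1' hM2
    have h0 := h f hf
    rw [map_zero] at h0
    exact absurd (le_zero_iff.1 h0) (hu.map_ne_zero hf hy)
  have hu0 : u ≠ 0 := SemiringPreorder.ne_zero_of_one_le h10 hu.1
  refine SemiringPreorder.asympGE_of_forall_exists hu h10 hx fun j _ => ?_
  have hyj := hu.pow_ne_zero h10 hy j
  have hxj := hu.pow_ne_zero h10 hx j
  obtain ⟨t, ht, n, hn⟩ := SemiringPreorder.exists_mul_le_of_forall_spectrum hT hMS hTS hu h10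
    hM1' hM2
    (a := y ^ j) (b := x ^ j * u) hyj (hu.mul_ne_zero h10 hxj hu0) (fun g hg => by
      rw [map_mul, map_pow, map_pow]
      have := h g hg
      calc g y ^ j ≤ g x ^ j := by gcongr
        _ ≤ g x ^ j * g u := le_mul_of_one_le_right (by positivity) (hu.one_le_map hg))
  have hpq : P.le (t * (y ^ j * u)) (t * (n * (x ^ j * u ^ 2))) := by
    convert P.mul_right _ _ u hn using 1 <;> ring
  have ht0 : t ≠ 0 := fun h0 => hT (h0 ▸ ht)
  rcases SemiringPreorder.exists_forall_pow_le_or_exists_mem_spectrum hu h10 ht0 hyj hpq with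
    ⟨w, hw⟩ | ⟨g, hg, hle⟩
  · obtain ⟨K, hK⟩ := hu.exists_le_pow w
    -- At exponent `K + 1` the factor `w ≼ u ^ K` costs at most one `u` per factor of `x ^ j * u ^
    -- 2`. Taking `k`-th powers with `c` kept as a common factor leaves only the constant overhead
    -- `u ^ l`.
    obtain ⟨c, hc, hcw⟩ := hw (K + 1)
    obtain ⟨l, hl⟩ := hu.exists_le_pow (c : S)
    refine ⟨K + 1, by omega, l, fun k => ?_⟩
    calc P.le ((y ^ j) ^ ((K + 1) * k)) (c * (y ^ j) ^ ((K + 1) * k)) :=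
          P.le_mul_of_one_le _ (P.one_le_natCast hc)
      P.le _ (c * ((y ^ j) ^ (K + 1)) ^ k) := P.le_of_eq (by rw [pow_mul])
      P.le _ (c * (w * (x ^ j * u ^ 2) ^ (K + 1)) ^ k) := P.mul_pow_le hcw k
      P.le _ (u ^ l * (u ^ (K + 1) * (x ^ j * u ^ 2) ^ (K + 1)) ^ k) :=
          P.mul_le_mul hl (P.pow_le_pow (P.mul_right _ _ _
            (P.trans _ _ _ hK (P.pow_le_pow_right hu.1 (Nat.le_succ K)))) k)
      P.le _ (u ^ l * (u ^ 3 * x ^ j) ^ ((K + 1) * k)) := P.le_of_eq (by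
        rw [← mul_pow, ← pow_mul, show u * (x ^ j * u ^ 2) = u ^ 3 * x ^ j by ring])
      P.le _ _ := P.le_of_eq (by rw [mul_pow, pow_add, ← pow_mul u 3, mul_assoc])
  · exfalso
    refine absurd hle (not_le.2 ?_)
    simp only [map_mul, map_pow]
    have h₁ := h g hg
    have h₂ := pos_iff_ne_zero.2 (hu.map_ne_zero hg hx)
    calc g y ^ j ≤ g x ^ j := by gcongr
      _ < g x ^ j * g u ^ 2 :=
        lt_mul_of_one_lt_right (by positivity) (one_lt_pow₀ (hu.one_lt_map hg) two_ne_zero)
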